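/- Let $k$ be a finite field, $V$ a $k$-vector space of finite dimension $d$, and $K$ an algebraically closed extension field of $k$ (for example $K=\overline{k}$); write $W_K = W\otimes_k K$ for a $k$-vector space $W$. An $\mathbb R$-filtration on a finite-dimensional $K$-vector space $W$ is a decreasing family $(\mathcal F^x)_{x\in\mathbb R}$ of $K$-subspaces of $W$ with $\mathcal F^x=W$ for $x\ll 0$, $\mathcal F^x=0$ for $x\gg 0$ and $\bigcap_{y<x}\mathcal F^y=\mathcal F^x$ for all $x$. Put $gr^x_{\mathcal F}(W)=\mathcal F^x/\bigcup_{y>x}\mathcal F^y$. A subspace $U\subset W$ carries the induced filtration $U\cap\mathcal F^x$. Fix a function $g:\mathbb R\to\mathbb Z_{\ge 0}$ of finite support with $\sum_x g(x)=d$ and $\sum_x x\,g(x)=0$. Let $\mathcal F\ell_g$ be the flag variety of $\mathbb R$-filtrations $\mathcal F$ on $V_K$ with $\dim_K gr^x_{\mathcal F}(V_K)=g(x)$ for all $x\in\mathbb R$, with the Zariski topology (given by the Plücker embeddings of the steps $\mathcal F^x$, $x\in\operatorname{supp} g$). A nontrivial subfunction of $g$ is a function $h:\mathbb R\to\mathbb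 Z_{\ge 0}$ with $h\le g$ pointwise, $h\ne 0$ and $h\neq g$; put $\|h\|=\sum_x h(x)$, and let $x_1\ge\dots\ge x_{\|h\|}$ be the decreasing sequence in which each $x$ occurs $h(x)$ times. For nontrivial subfunctions $h,h'$ of $g$, with sequences $(x_i)$ and $(x_i')$, write $h'\ge h$ if $\|h'\|=\|h\|$ and $x'_i\ge x_i$ for all $i$. Let $$Y(h)=\{\mathcal F\in\mathcal F\ell_g : \text{there is a $k$-subspace } U\subset V \text{ with } \dim_k U=\|h\| \text{ and } \dim_K gr^x_{\mathcal F}(U_K)=h(x)\ \forall x\in\mathbb R\}.$$ Then for every nontrivial subfunction $h$ of $g$, the Zariski closure of $Y(h)$ in $\mathcal F\ell_g$ is $$\overline{Y(h)}=\bigcup_{h'\ge h} Y(h'),$$ the union being over all nontrivial subfunctions $h'$ of $g$ with $h'\ge h$. -/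

import Mathlib

open scoped TensorProduct

/-- An `ℝ`-filtration on a `K`-vector space `W`: a decreasing family `x ↦ F x` of subspaces with
`F x = W` for `x ≪ 0`, `F x = 0` for `x ≫ 0`, and `⋂_{y < x} F y = F x` for all `x`. -/
structure RFiltration (K W : Type*) [Field K] [AddCommGroup W] [Module K W] where
  toFun : ℝ → Submodule K W
  antitone' : Antitone toFun
  exists_eq_top' : ∃ a : ℝ, ∀ x ≤ a, toFun x = ⊤
  exists_eq_bot' : ∃ b : ℝ, ∀ x ≥ b, toFun x = ⊥
  iInf_lt' : ∀ x : ℝ, ⨅ y : Set.Iio x, toFun y = toFun x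

namespace RFiltration

variable {K W : Type*} [Field K] [AddCommGroup W] [Module K W]

instance : CoeFun (RFiltration K W) (fun _ => ℝ → Submodule K W) := ⟨RFiltration.toFun⟩

/-- `F^{x+} = ⋃_{y > x} F y`. (The family is a chain, so the union is the supremum.) -/
def plus (F : RFiltration K W) (x : ℝ) : Submodule K W := ⨆ y : Set.Ioi x, F y

/-- The graded piece `gr^x = F^x / F^{x+}`. -/
abbrev Gr (F : RFiltration K W) (x : ℝ) : Type _ := F x ⧸ (F.plus x).submoduleOf (F x)

/-- The filtration `x ↦ U ∩ F x` induced on a subspace `U`. -/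
def restrict (F : RFiltration K W) (U : Submodule K W) : RFiltration K U where
  toFun x := (F x).submoduleOf U
  antitone' _ _ hxy := Submodule.comap_mono (F.antitone' hxy)
  exists_eq_top' := by
    obtain ⟨a, ha⟩ := F.exists_eq_top'
    exact ⟨a, fun x hx => by simp [Submodule.submoduleOf, ha x hx]⟩
  exists_eq_bot' := by
    obtain ⟨b, hb⟩ := F.exists_eq_bot'
    exact ⟨b, fun x hx => by simp [Submodule.submoduleOf, hb x hx]⟩
  iInf_lt' x := by
    rw [← F.iInf_lt' x]
    exact (Submodule.comap_iInf U.subtype fun y : Set.Iio x => F y).symm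

end RFiltration

/-- The points over `K` of the flag variety attached to the `k`-vector space `V` and the
function `g : ℝ → ℤ_{≥ 0}` of finite support: the filtrations `F` on `V_K = K ⊗ V`
with `dim gr^x(V_K) = g x` for all `x`. -/
structure FlagVariety (k K V : Type*) [Field k] [Field K] [Algebra k K] [AddCommGroup V]
    [Module k V] (g : ℝ →₀ ℕ) where
  filtration : RFiltration K (K ⊗[k] V)
  finrank_gr : ∀ x : ℝ, Module.finrank K (filtration.Gr x) = g x

namespace FlagVariety

variable (k K V : Type*) [Field k] [Field K] [Algebra k K] [AddCommGroup V] [Module k V]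
  (g : ℝ →₀ ℕ)

/-- `∑_{y ≥ x} g y`, the dimension of the step `F x` of a filtration of type `g`. -/
noncomputable def stepDim (x : ℝ) : ℕ := ∑ y ∈ g.support with x ≤ y, g y

/-- Labels of the Plücker coordinates: a jump `x` of the filtration and `n = stepDim g x` linear
forms `φ₁, …, φₙ` on `V_K`; the label stands for the linear form `φ₁ ∧ ⋯ ∧ φₙ` on `⋀ⁿ V_K`.
(Such forms span the dual of `⋀ⁿ V_K`; no basis of `V` is singled out.) -/
abbrev PluckerIndex : Type _ :=
  Σ x : g.support, (Fin (stepDim g x) → Module.Dual K (K ⊗[k] V))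

variable {k K V g}

/-- A choice of an ordered basis of each of the steps `F x`, `x` a jump. -/
def IsFrame (F : FlagVariety k K V g)
    (f : ∀ x : g.support, Fin (stepDim g x) → K ⊗[k] V) : Prop :=
  ∀ x : g.support, LinearIndependent K (f x) ∧
    Submodule.span K (Set.range (f x)) = F.filtration x

/-- The Plücker coordinate `det (φ_a (f_b))`, i.e. the value of `φ₁ ∧ ⋯ ∧ φₙ` at
`f₁ ∧ ⋯ ∧ fₙ`. -/
noncomputable def pluckerCoord (f : ∀ x : g.support, Fin (stepDim g x) → K ⊗[k] V)
    (c : PluckerIndex k K V g) : K :=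
  (Matrix.of fun a b => c.2 a (f c.1 b)).det

/-- A polynomial in the Plücker coordinates is multihomogeneous if it is homogeneous separately
in the coordinates belonging to each jump `x`. -/
def IsMultihomogeneous (p : MvPolynomial (PluckerIndex k K V g) K) : Prop :=
  ∃ m : g.support →₀ ℕ,
    MvPolynomial.IsWeightedHomogeneous
      (fun c : PluckerIndex k K V g => Finsupp.single c.1 1) p m

/-- The non-vanishing locus of `p` on the flag variety. For multihomogeneous `p` it does not
matter which frame of `F` is used. -/
def basicOpen (p : MvPolynomial (PluckerIndex k K V g) K) : Set (FlagVariety k K V g) :=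
  {F | ∃ f, F.IsFrame f ∧ MvPolynomial.eval (pluckerCoord f) p ≠ 0}

/-- The Zariski topology on the flag variety, as a subvariety of the product over the jumps `x`
of the projective spaces `ℙ(⋀ⁿ V_K)`, `n = stepDim g x`, via the Plücker embeddings: it is
generated by the non-vanishing loci of the multihomogeneous polynomials in the Plücker
coordinates. -/
instance zariskiTopology : TopologicalSpace (FlagVariety k K V g) :=
  TopologicalSpace.generateFrom
    {D | ∃ p : MvPolynomial (PluckerIndex k K V g) K, IsMultihomogeneous p ∧ D = basicOpen p}

end FlagVariety

/-- The nontrivial subfunctions of `g`: functions `h` with `h ≤ g` pointwise, `h ≠ 0`, `h ≠ g`. -/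
def NontrivialSubfunction (g : ℝ →₀ ℕ) : Set (ℝ →₀ ℕ) := {h | h ≤ g ∧ h ≠ 0 ∧ h ≠ g}

/-- The tuple `(y₁ ≥ y₂ ≥ ⋯)` in which each `x` occurs `h x` times. -/
noncomputable def sortedSupport (h : ℝ →₀ ℕ) : List ℝ := (Finsupp.toMultiset h).sort (· ≥ ·)

/-- `h' ≥ h`: both functions have the same length `∑ x, h x`, and the decreasing tuples
`(x'₁ ≥ x'₂ ≥ ⋯)` of `h'` and `(x₁ ≥ x₂ ≥ ⋯)` of `h` satisfy `x'ᵢ ≥ xᵢ` for all `i`. -/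
def SubfunctionGE (h' h : ℝ →₀ ℕ) : Prop :=
  h'.degree = h.degree ∧ List.Forall₂ (· ≥ ·) (sortedSupport h') (sortedSupport h)

/-- `Y(h)`: the filtrations `F` for which there is a `k`-rational subspace `U` of `V` with
`dim U = ∑ x, h x` such that `dim gr^x(U_K) = h x` for all `x`, where `U_K` carries the
filtration induced by `F`. -/
def subfunctionLocus (k K V : Type*) [Field k] [Field K] [Algebra k K] [AddCommGroup V]
    [Module k V] (g h : ℝ →₀ ℕ) : Set (FlagVariety k K V g) :=
  {F | ∃ U : Submodule k V, Module.finrank k U = h.degree ∧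
    ∀ x : ℝ, Module.finrank K ((F.filtration.restrict (U.baseChange K)).Gr x) = h x}

/-! Since `k` is finite, `V` has only finitely many `k`-subspaces, so `Y(h)` is a finite union of
Schubert cells, one for each `U` of dimension `‖h‖`. Types are read off from step dimensions
(`finrank_gr_eq_iff`), and `h' ≥ h` becomes equal degree plus pointwise comparison of step
dimensions (`subfunctionGE_iff`).

For `⊆`: the conditions dim (F^x ∩ U_K) ≥ `stepDim h x` are closed (`isClosed_le_finrank_inf`), and
a filtration satisfying them induces on `U_K` a type dominating `h`.

For `⊇`: fix `U` and pass from `h'` to `h` by moving single units to smaller values (`exists_move`).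
Each move is realised by transvections `v ↦ v + t φ(v) e`: for `t ≠ 0` they carry `F` into the cell
of the moved type, while Plücker coordinates are polynomial in `t`, so the family tends to `F`
(`tendsto_map_transvection`); `K` is infinite, so `F` lies in the closure. -/

open Filter Topology

/-! ### Local behaviour of real filtrations -/

namespace RFiltration

variable {K W : Type*} [Field K] [AddCommGroup W] [Module K W]

theorem plus_le (F : RFiltration K W) (x : ℝ) : F.plus x ≤ F x :=
  iSup_le fun y => F.antitone' y.2.le

theorem le_plus (F : RFiltration K W) {x y : ℝ} (hxy : x < y) : F y ≤ F.plus x :=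
  le_iSup (fun y : Set.Ioi x => F y) ⟨y, hxy⟩

variable [FiniteDimensional K W]

/-- By finite dimension some step to the right of `x` is maximal; the steps form a chain, so it is
the whole union and is attained all the way down to `x`. -/
theorem eventually_eq_plus (F : RFiltration K W) (x : ℝ) :
    ∀ᶠ y in 𝓝[>] x, F y = F.plus x := by
  obtain ⟨_, ⟨y₀, hy₀, rfl⟩, hmax⟩ := (wellFounded_gt (α := Submodule K W)).has_min
    (F '' Set.Ioi x) ⟨_, x + 1, by simp, rfl⟩
  filter_upwards [Ioc_mem_nhdsGT (Set.mem_Ioi.1 hy₀)] with y hy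
  refine le_antisymm (F.le_plus hy.1) (iSup_le fun z => ?_)
  rcases le_total y z with hyz | hyz
  · exact F.antitone' hyz
  · have h1 : F y₀ ≤ F z := F.antitone' (hyz.trans hy.2)
    have h2 : F y₀ = F z := by
      by_contra hne
      exact hmax _ ⟨z, z.2, rfl⟩ (lt_of_le_of_ne h1 hne)
    exact h2 ▸ F.antitone' hy.2

theorem eventually_eq_left (F : RFiltration K W) (x : ℝ) :
    ∀ᶠ y in 𝓝[<] x, F y = F x := by
  obtain ⟨_, ⟨y₀, hy₀, rfl⟩, hmin⟩ := (wellFounded_lt (α := Submodule K W)).has_min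
    (F '' Set.Iio x) ⟨_, x - 1, by simp, rfl⟩
  filter_upwards [Ico_mem_nhdsLT (Set.mem_Iio.1 hy₀)] with y hy
  refine le_antisymm ?_ (F.antitone' hy.2.le)
  rw [← F.iInf_lt' x]
  refine le_iInf fun z => ?_
  rcases le_total z.1 y with hyz | hyz
  · exact F.antitone' hyz
  · have h1 : F z ≤ F y₀ := F.antitone' (hy.1.trans hyz)
    have h2 : F z = F y₀ := by
      by_contra hne
      exact hmin _ ⟨z, z.2, rfl⟩ (lt_of_le_of_ne h1 hne)
    exact h2 ▸ F.antitone' hy.1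

theorem finrank_gr_add_finrank_plus (F : RFiltration K W) (x : ℝ) :
    Module.finrank K (F.Gr x) + Module.finrank K (F.plus x) = Module.finrank K (F x) := by
  rw [← Submodule.finrank_quotient_add_finrank ((F.plus x).submoduleOf (F x)),
    (Submodule.submoduleOfEquivOfLe (F.plus_le x)).finrank_eq]

omit [FiniteDimensional K W] in
theorem finrank_restrict (F : RFiltration K W) (U : Submodule K W) (x : ℝ) :
    Module.finrank K (F.restrict U x) = Module.finrank K ↥(F x ⊓ U) := by
  rw [← Submodule.finrank_map_subtype_eq U (F.restrict U x)]
  change Module.finrank K ((F x).comap U.subtype |>.map U.subtype) = _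
  rw [Submodule.map_comap_subtype, inf_comm]

/-- The transport of a filtration along a linear automorphism. -/
def map (F : RFiltration K W) (e : W ≃ₗ[K] W) : RFiltration K W where
  toFun x := (F x).map (e : W →ₗ[K] W)
  antitone' _ _ hxy := Submodule.map_mono (F.antitone' hxy)
  exists_eq_top' := by
    obtain ⟨a, ha⟩ := F.exists_eq_top'
    exact ⟨a, fun x hx => by simp [ha x hx]⟩
  exists_eq_bot' := by
    obtain ⟨b, hb⟩ := F.exists_eq_bot'
    exact ⟨b, fun x hx => by simp [hb x hx]⟩
  iInf_lt' x := by
    rw [← F.iInf_lt' x]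
    exact (map_iInf (Submodule.orderIsoMapComap e) fun y : Set.Iio x => F y).symm

end RFiltration

/-! ### Step dimensions, types and the dominance order -/

namespace FlagVariety

theorem stepDim_eq_sum (g : ℝ →₀ ℕ) (x : ℝ) :
    stepDim g x = g.sum fun y n => if x ≤ y then n else 0 := by
  simp [stepDim, Finsupp.sum, Finset.sum_filter]

theorem stepDim_add (g h : ℝ →₀ ℕ) (x : ℝ) :
    stepDim (g + h) x = stepDim g x + stepDim h x := by
  simp only [stepDim_eq_sum]
  refine Finsupp.sum_add_index' (by simp) fun y m n => ?_
  split_ifs <;> rfl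

theorem stepDim_single (a : ℝ) (n : ℕ) (x : ℝ) :
    stepDim (Finsupp.single a n) x = if x ≤ a then n else 0 := by
  simp [stepDim_eq_sum]

theorem stepDim_eq_countP (g : ℝ →₀ ℕ) (x : ℝ) :
    stepDim g x = (Finsupp.toMultiset g).countP (x ≤ ·) := by
  induction g using Finsupp.induction_linear with
  | zero => simp [stepDim_eq_sum]
  | add f g hf hg => rw [stepDim_add, map_add, Multiset.countP_add, hf, hg]
  | single a n =>
    rw [stepDim_single, Finsupp.toMultiset_single, Multiset.countP_nsmul]
    by_cases hx : x ≤ a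
    · simp [hx, Multiset.countP_eq_card_filter, Multiset.filter_singleton]
    · simp [hx, Multiset.countP_eq_card_filter, Multiset.filter_singleton]

theorem stepDim_mono_of_forall_le {g h : ℝ →₀ ℕ} {x : ℝ} (hgh : ∀ y, x ≤ y → g y ≤ h y) :
    stepDim g x ≤ stepDim h x := by
  refine (Finset.sum_le_sum fun y hy => hgh y (Finset.mem_filter.1 hy).2).trans ?_
  refine Finset.sum_le_sum_of_ne_zero fun y hy hne => ?_
  simp_all

theorem exists_stepDim_eq_degree (g : ℝ →₀ ℕ) : ∃ a, ∀ x ≤ a, stepDim g x = g.degree := by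
  obtain ⟨a, ha⟩ := g.support.finite_toSet.bddBelow
  refine ⟨a, fun x hx => ?_⟩
  rw [stepDim, Finset.filter_true_of_mem fun y hy => hx.trans (ha hy)]
  rfl

theorem exists_stepDim_eq_zero (g : ℝ →₀ ℕ) : ∃ b, ∀ x ≥ b, stepDim g x = 0 := by
  obtain ⟨b, hb⟩ := g.support.finite_toSet.bddAbove
  refine ⟨b + 1, fun x hx => ?_⟩
  rw [stepDim, Finset.filter_false_of_mem, Finset.sum_empty]
  intro y hy hxy
  have := hb hy
  linarith

theorem eventually_stepDim_left (g : ℝ →₀ ℕ) (x : ℝ) :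
    ∀ᶠ y in 𝓝[<] x, stepDim g y = stepDim g x := by
  have : ∀ᶠ y in 𝓝[<] x, ∀ z ∈ g.support, (y ≤ z ↔ x ≤ z) := by
    refine (Filter.eventually_all_finset _).2 fun z _ => ?_
    rcases lt_or_ge z x with hz | hz
    · filter_upwards [Ioo_mem_nhdsLT hz] with y hy
      exact iff_of_false (not_le.2 hy.1) (not_le.2 hz)
    · filter_upwards [self_mem_nhdsWithin] with y hy
      exact iff_of_true ((Set.mem_Iio.1 hy).le.trans hz) hz
  filter_upwards [this] with y hy
  rw [stepDim, stepDim, Finset.filter_congr hy]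

theorem eventually_stepDim_right (g : ℝ →₀ ℕ) (x : ℝ) :
    ∀ᶠ y in 𝓝[>] x, g x + stepDim g y = stepDim g x := by
  induction g using Finsupp.induction_linear with
  | zero => simp [stepDim_eq_sum]
  | add f g hf hg =>
    filter_upwards [hf, hg] with y h1 h2
    rw [stepDim_add, stepDim_add, ← h1, ← h2, Finsupp.add_apply]
    omega
  | single a n =>
    simp only [stepDim_single, Finsupp.single_apply]
    rcases lt_trichotomy x a with h | h | h
    · filter_upwards [Ioo_mem_nhdsGT h] with y hy
      simp [h.le, hy.2.le, h.ne']
    · filter_upwards [self_mem_nhdsWithin] with y hy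
      simp [h, not_le.2 (h ▸ Set.mem_Ioi.1 hy)]
    · filter_upwards [self_mem_nhdsWithin] with y hy
      simp [not_le.2 h, h.ne, not_le.2 (h.trans hy)]

end FlagVariety

namespace RFiltration

open FlagVariety

variable {K W : Type*} [Field K] [AddCommGroup W] [Module K W] [FiniteDimensional K W]

/-- Both sides are left continuous step functions with the same jumps, so their difference is
locally constant on the connected line, and it vanishes far to the right. -/
theorem finrank_gr_eq_iff (F : RFiltration K W) (g : ℝ →₀ ℕ) :
    (∀ x, Module.finrank K (F.Gr x) = g x) ↔ ∀ x, Module.finrank K (F x) = stepDim g x := by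
  constructor
  · intro hF
    set E : ℝ → ℤ := fun x => (Module.finrank K (F x) : ℤ) - stepDim g x with hE
    have hloc : IsLocallyConstant E := by
      rw [IsLocallyConstant.iff_eventually_eq]
      intro x
      rw [← nhdsNE_sup_pure x, ← nhdsLT_sup_nhdsGT]
      simp only [eventually_sup, eventually_pure, and_true]
      constructor
      · filter_upwards [F.eventually_eq_left x, eventually_stepDim_left g x] with y h1 h2
        simp only [hE]
        rw [h1, h2]
      · filter_upwards [F.eventually_eq_plus x, eventually_stepDim_right g x] with y h1 h2
        have := F.finrank_gr_add_finrank_plus x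
        have h3 := hF x
        simp only [hE]
        rw [h1]
        omega
    obtain ⟨b, hb⟩ := F.exists_eq_bot'
    obtain ⟨b', hb'⟩ := exists_stepDim_eq_zero g
    intro x
    have h0 : E x = E (max b b') := hloc.apply_eq_of_isPreconnected isPreconnected_univ trivial trivial
    simp only [hE] at h0
    rw [hb _ (le_max_left b b'), hb' _ (le_max_right b b'), finrank_bot] at h0
    omega
  · intro hF x
    obtain ⟨y, h1, h2⟩ := ((F.eventually_eq_plus x).and (eventually_stepDim_right g x)).exists
    have h3 := F.finrank_gr_add_finrank_plus x
    have h4 := hF x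
    have h5 := hF y
    rw [h1] at h5
    omega

end RFiltration

namespace FlagVariety

theorem forall₂_ge_iff_countP {l' l : List ℝ} (hl' : l'.Pairwise (· ≥ ·))
    (hl : l.Pairwise (· ≥ ·)) (hlen : l'.length = l.length) :
    List.Forall₂ (· ≥ ·) l' l ↔ ∀ x : ℝ, l.countP (x ≤ ·) ≤ l'.countP (x ≤ ·) := by
  constructor
  · intro h x
    clear hl hl' hlen
    induction h with
    | nil => simp
    | cons hab _ ih =>
      simp only [List.countP_cons, decide_eq_true_eq]
      split_ifs with h1 h2
      · omega
      · exact absurd (h1.trans hab) h2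
      all_goals omega
  · induction l' generalizing l with
    | nil =>
      intro _
      obtain rfl := List.eq_nil_of_length_eq_zero hlen.symm
      exact .nil
    | cons a' t' ih =>
      intro h
      cases l with
      | nil => simp at hlen
      | cons a t =>
        rw [List.pairwise_cons] at hl' hl
        have haa : a ≤ a' := by
          have h1 : 0 < (a' :: t').countP (a ≤ ·) := lt_of_lt_of_le (by simp) (h a)
          obtain ⟨z, hz, hz'⟩ := List.countP_pos_iff.1 h1
          have hz' : a ≤ z := by simpa using hz'
          rcases List.mem_cons.1 hz with rfl | hz
          · exact hz'
          · exact hz'.trans (hl'.1 z hz)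
        refine .cons haa (ih hl'.2 hl.2 (by simpa using hlen) fun x => ?_)
        rcases le_or_gt x a with hx | hx
        · have := h x
          simpa [List.countP_cons, hx, hx.trans haa] using this
        · rw [List.countP_eq_zero.2]
          · exact Nat.zero_le _
          · intro z hz
            simpa using (hl.1 z hz).trans_lt hx

end FlagVariety

theorem subfunctionGE_iff {h' h : ℝ →₀ ℕ} :
    SubfunctionGE h' h ↔ h'.degree = h.degree ∧
      ∀ x, FlagVariety.stepDim h x ≤ FlagVariety.stepDim h' x := by
  refine and_congr_right fun hdeg => ?_
  have hlen (f : ℝ →₀ ℕ) : (sortedSupport f).length = f.degree := by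
    rw [sortedSupport, Multiset.length_sort, Finsupp.card_toMultiset]
    rfl
  have hcount (f : ℝ →₀ ℕ) (x : ℝ) :
      FlagVariety.stepDim f x = (sortedSupport f).countP (x ≤ ·) := by
    rw [FlagVariety.stepDim_eq_countP, ← Multiset.coe_countP, sortedSupport, Multiset.sort_eq]
  rw [FlagVariety.forall₂_ge_iff_countP (l' := sortedSupport h') (l := sortedSupport h)
    (Multiset.pairwise_sort _ _) (Multiset.pairwise_sort _ _) (by rw [hlen, hlen, hdeg])]
  simp only [hcount]

theorem Finsupp.eq_of_le_of_degree_eq {h g : ℝ →₀ ℕ} (hle : h ≤ g) (hdeg : h.degree = g.degree) :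
    h = g := by
  have h1 : h + (g - h) = g := add_tsub_cancel_of_le hle
  have h2 : (g - h).degree = 0 := by
    have := congrArg Finsupp.degree h1
    rw [map_add] at this
    omega
  rw [(Finsupp.degree_eq_zero_iff _).1 h2] at h1
  simpa using h1

namespace FlagVariety

/-- If `h'` strictly dominates `h`, one unit of `h'` can be moved from some `a` to some `b < a`
with `h' b < h b` so that the result still dominates `h` and is closer to it. -/
theorem exists_move {h' h : ℝ →₀ ℕ} (hdeg : h'.degree = h.degree)
    (hstep : ∀ x, stepDim h x ≤ stepDim h' x) (hne : h' ≠ h) :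
    ∃ (c : ℝ →₀ ℕ) (a b : ℝ), b < a ∧ h' = c + Finsupp.single a 1 ∧ h' b < h b ∧
      (∀ x, stepDim h x ≤ stepDim (c + Finsupp.single b 1) x) ∧
      (c + Finsupp.single b 1 - h).degree < (h' - h).degree := by
  -- Take the largest deficient `b`. If no `a > b` had an excess, `stepDim h'` would be smaller than
  -- `stepDim h` at `b`.
  obtain ⟨b, hb, hbmax⟩ : ∃ b, h' b < h b ∧ ∀ y, b < y → h y ≤ h' y := by
    have hne' : (h.support.filter fun y => h' y < h y).Nonempty := by
      by_contra hemp
      refine hne (Finsupp.eq_of_le_of_degree_eq (h := h) (g := h') (fun y => ?_) hdeg.symm).symm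
      by_contra hy
      rw [not_le] at hy
      exact hemp ⟨y, by simp [hy]; omega⟩
    obtain ⟨b, hb, hmax⟩ := Finset.exists_max_image _ id hne'
    refine ⟨b, (Finset.mem_filter.1 hb).2, fun y hy => ?_⟩
    by_contra hlt
    rw [not_le] at hlt
    exact absurd (hmax y (by simp [hlt]; omega)) (not_le.2 hy)
  obtain ⟨a, hba, ha⟩ : ∃ a, b < a ∧ h a < h' a := by
    by_contra hcon
    push Not at hcon
    have h1 : stepDim (h' + Finsupp.single b 1) b ≤ stepDim h b := by
      refine stepDim_mono_of_forall_le fun y hy => ?_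
      rcases hy.eq_or_lt with rfl | hy
      · simpa using hb
      · simpa [hy.ne'] using hcon y hy
    rw [stepDim_add, stepDim_single, if_pos le_rfl] at h1
    have := hstep b
    omega
  have hc : h' = (h' - Finsupp.single a 1) + Finsupp.single a 1 := by
    refine (tsub_add_cancel_of_le fun y => ?_).symm
    rcases eq_or_ne y a with rfl | hy
    · simp; omega
    · simp [hy]
  set c := h' - Finsupp.single a 1 with hcdef
  refine ⟨c, a, b, hba, hc, hb, fun x => ?_, ?_⟩
  · rw [stepDim_add, stepDim_single]
    split_ifs with hxb
    · have h1 := hstep x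
      rw [hc, stepDim_add, stepDim_single, if_pos (hxb.trans hba.le)] at h1
      exact h1
    · refine stepDim_mono_of_forall_le fun y hy => ?_
      have hyb := hbmax y ((not_le.1 hxb).trans_le hy)
      rcases eq_or_ne y a with rfl | hya
      · simp [hcdef]; omega
      · simpa [hcdef, hya] using hyb
  · have h1 : c + Finsupp.single b 1 - h + Finsupp.single a 1 = h' - h := by
      ext y
      rcases eq_or_ne y a with rfl | hya
      · simp [hcdef, hba.ne]; omega
      · rcases eq_or_ne y b with rfl | hyb
        · simp [hcdef, hya]; omega
        · simp [hcdef, hya, hyb]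
    have h2 := congrArg Finsupp.degree h1
    rw [map_add, Finsupp.degree_single] at h2
    omega

end FlagVariety

/-! ### Coordinates, determinants and intersections -/

section LinearAlgebra

variable {K W : Type*} [Field K] [AddCommGroup W] [Module K W]

theorem Submodule.exists_linearIndependent_span_eq [FiniteDimensional K W] (A : Submodule K W)
    {n : ℕ} (hn : Module.finrank K A = n) :
    ∃ f : Fin n → W, LinearIndependent K f ∧ Submodule.span K (Set.range f) = A := by
  let b := Module.finBasisOfFinrankEq K A hn
  refine ⟨A.subtype ∘ b, b.linearIndependent.map' A.subtype A.ker_subtype, ?_⟩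
  have := congrArg (Submodule.map A.subtype) b.span_eq
  rwa [Submodule.map_span, ← Set.range_comp, Submodule.map_subtype_top] at this

/-- Coordinates on `A`, extended to `W` so that `U` gets the smallest possible image. -/
theorem Submodule.exists_coordinates [FiniteDimensional K W] (A U : Submodule K W)
    {n : ℕ} (hn : Module.finrank K A = n) :
    ∃ L : W →ₗ[K] Fin n → K, (∀ v ∈ A, L v = 0 → v = 0) ∧
      Module.finrank K (U.map L) ≤ Module.finrank K ↥(A ⊓ U) := by
  -- Projecting onto `A` along a complement `D` containing `C` kills `C`, so `U` and `A ⊓ U` have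
  -- the same image.
  obtain ⟨C, hCU, hC, hCA⟩ : ∃ C ≤ U, U ≤ (A ⊓ U) ⊔ C ∧ Disjoint C A := by
    obtain ⟨C, hdis, hcod⟩ := exists_isCompl (A ⊓ U)
    refine ⟨C ⊓ U, inf_le_right, ?_, ?_⟩
    · rw [← sup_inf_assoc_of_le C inf_le_right, hcod.eq_top, top_inf_eq]
    · rw [disjoint_iff, inf_assoc, inf_comm U, inf_comm]
      exact hdis.eq_bot
  obtain ⟨D, hCD, hD⟩ := hCA.exists_isCompl
  let b := Module.finBasisOfFinrankEq K A hn
  let q := A.projectionOnto D hD.symm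
  have hqC : ∀ v ∈ C, q v = 0 := fun v hv =>
    (Submodule.projectionOnto_apply_eq_zero_iff hD.symm).2 (hCD hv)
  refine ⟨b.equivFun.toLinearMap ∘ₗ q, fun v hv h0 => ?_, ?_⟩
  · have h1 : q v = 0 := b.equivFun.injective (by simpa using h0)
    have h2 : q v = ⟨v, hv⟩ := Submodule.projectionOnto_apply_left hD.symm ⟨v, hv⟩
    rw [h1] at h2
    exact (congrArg Subtype.val h2).symm
  · refine (Submodule.finrank_mono (t := (A ⊓ U).map (b.equivFun.toLinearMap ∘ₗ q)) ?_).trans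
      (Submodule.finrank_map_le _ _)
    refine (Submodule.map_mono hC).trans ?_
    rw [Submodule.map_sup, sup_le_iff]
    refine ⟨le_rfl, ?_⟩
    rintro _ ⟨v, hv, rfl⟩
    simp [hqC v hv]

theorem Submodule.finrank_inf_le_finrank_map {M : Type*} [AddCommGroup M] [Module K M]
    [FiniteDimensional K M] {A : Submodule K W} (U : Submodule K W) {L : W →ₗ[K] M}
    (hL : ∀ v ∈ A, L v = 0 → v = 0) :
    Module.finrank K ↥(A ⊓ U) ≤ Module.finrank K (U.map L) := by
  let B : ↥(A ⊓ U) →ₗ[K] U.map L :=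
    (L ∘ₗ (A ⊓ U).subtype).codRestrict _ fun v => Submodule.mem_map_of_mem v.2.2
  refine LinearMap.finrank_le_finrank_of_injective (f := B) ?_
  rw [injective_iff_map_eq_zero]
  exact fun v hv => Subtype.ext (hL v v.2.1 (congrArg Subtype.val hv))

theorem Matrix.det_apply_ne_zero_iff {n : ℕ} {f : Fin n → W} (hf : LinearIndependent K f)
    (L : W →ₗ[K] Fin n → K) :
    (Matrix.of fun a b => L (f b) a).det ≠ 0 ↔
      ∀ v ∈ Submodule.span K (Set.range f), L v = 0 → v = 0 := by
  have key (w : Fin n → K) :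
      (Matrix.of fun a b => L (f b) a).mulVec w = L (∑ i, w i • f i) := by
    ext a
    simp [Matrix.mulVec, dotProduct, mul_comm]
  rw [Ne, ← Matrix.exists_mulVec_eq_zero_iff]
  push Not
  simp only [key, Submodule.mem_span_range_iff_exists_fun]
  constructor
  · rintro h _ ⟨w, rfl⟩ hw
    by_contra hne
    exact h w (by rintro rfl; simp at hne) hw
  · intro h w hw hw0
    exact hw (funext (Fintype.linearIndependent_iff.1 hf w (h _ ⟨w, rfl⟩ hw0)))

end LinearAlgebra

/-! ### Closed conditions and unipotent families -/

namespace FlagVariety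

variable {k K V : Type*} [Field k] [Field K] [Algebra k K] [AddCommGroup V] [Module k V]
  [FiniteDimensional k V] {g : ℝ →₀ ℕ}

theorem finrank_step (F : FlagVariety k K V g) (x : ℝ) :
    Module.finrank K (F.filtration x) = stepDim g x :=
  (F.filtration.finrank_gr_eq_iff g).1 F.finrank_gr x

theorem exists_isFrame (F : FlagVariety k K V g) : ∃ f, F.IsFrame f := by
  choose f hf using fun x : g.support =>
    (F.filtration x).exists_linearIndependent_span_eq (F.finrank_step x)
  exact ⟨f, hf⟩

omit [FiniteDimensional k V] in
theorem isOpen_basicOpen_X (c : PluckerIndex k K V g) :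
    IsOpen (basicOpen (MvPolynomial.X c : MvPolynomial (PluckerIndex k K V g) K)) :=
  TopologicalSpace.isOpen_generateFrom_of_mem
    ⟨_, ⟨_, MvPolynomial.isWeightedHomogeneous_X _ _ c⟩, rfl⟩

/-- Plücker coordinates exist only at jumps; a nonzero step at `x` equals the step at the first jump
`≥ x`. -/
theorem exists_jump_step_eq (g : ℝ →₀ ℕ) {x : ℝ} (hx : stepDim g x ≠ 0) :
    ∃ x₀ : g.support, ∀ F : FlagVariety k K V g, F.filtration x₀ = F.filtration x := by
  have hne : (g.support.filter fun y => x ≤ y).Nonempty := by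
    by_contra hemp
    rw [Finset.not_nonempty_iff_eq_empty] at hemp
    exact hx (by rw [stepDim, hemp, Finset.sum_empty])
  obtain ⟨x₀, hx₀, hmin⟩ := Finset.exists_min_image _ id hne
  rw [Finset.mem_filter] at hx₀
  refine ⟨⟨x₀, hx₀.1⟩, fun F => ?_⟩
  refine Submodule.eq_of_le_of_finrank_eq (F.filtration.antitone' hx₀.2) ?_
  rw [finrank_step, finrank_step, stepDim, stepDim]
  congr 1
  refine Finset.filter_congr fun y hy => ⟨hx₀.2.trans, fun hxy => ?_⟩
  exact hmin y (Finset.mem_filter.2 ⟨hy, hxy⟩)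

/-- Choose `L` injective on the step of `F` with dim L(U) at most dim (F^x ∩ U). Injectivity of `L`
on the step of `F'` is the nonvanishing of one Plücker coordinate, and there dim (F'^x ∩ U) ≤ dim
L(U). -/
theorem isClosed_le_finrank_inf (U : Submodule K (K ⊗[k] V)) (x : ℝ) (n : ℕ) :
    IsClosed {F : FlagVariety k K V g | n ≤ Module.finrank K ↥(F.filtration x ⊓ U)} := by
  rw [← isOpen_compl_iff, isOpen_iff_forall_mem_open]
  intro F hF
  simp only [Set.mem_compl_iff, Set.mem_ofPred_eq, not_le] at hF
  by_cases hx : stepDim g x = 0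
  · refine ⟨Set.univ, fun F' _ => ?_, isOpen_univ, trivial⟩
    have : Module.finrank K ↥(F'.filtration x ⊓ U) ≤ Module.finrank K (F'.filtration x) :=
      Submodule.finrank_mono inf_le_left
    rw [finrank_step, hx] at this
    simp only [Set.mem_compl_iff, Set.mem_ofPred_eq, not_le]
    omega
  obtain ⟨x₀, hx₀⟩ := exists_jump_step_eq (k := k) (K := K) (V := V) g hx
  obtain ⟨L, hL, hLU⟩ := (F.filtration x₀).exists_coordinates U (F.finrank_step x₀)
  let c : PluckerIndex k K V g := ⟨x₀, fun a => LinearMap.proj a ∘ₗ L⟩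
  refine ⟨basicOpen (MvPolynomial.X c), fun F' hF' => ?_, isOpen_basicOpen_X c, ?_⟩
  · simp only [Set.mem_compl_iff, Set.mem_ofPred_eq, not_le]
    obtain ⟨f, hf, hne⟩ := hF'
    rw [MvPolynomial.eval_X] at hne
    have hinj := (Matrix.det_apply_ne_zero_iff (hf x₀).1 L).1 hne
    rw [(hf x₀).2, hx₀] at hinj
    rw [hx₀] at hLU
    exact ((Submodule.finrank_inf_le_finrank_map U hinj).trans hLU).trans_lt hF
  · obtain ⟨f, hf⟩ := F.exists_isFrame
    refine ⟨f, hf, ?_⟩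
    rw [MvPolynomial.eval_X]
    refine (Matrix.det_apply_ne_zero_iff (hf x₀).1 L).2 ?_
    rwa [(hf x₀).2]

/-- The transport of a point of the flag variety along a linear automorphism. -/
def map (F : FlagVariety k K V g) (e : (K ⊗[k] V) ≃ₗ[K] (K ⊗[k] V)) : FlagVariety k K V g where
  filtration := F.filtration.map e
  finrank_gr := by
    rw [RFiltration.finrank_gr_eq_iff]
    exact fun x => (LinearEquiv.finrank_map_eq e _).trans (F.finrank_step x)

theorem IsFrame.map {F : FlagVariety k K V g} {f} (hf : F.IsFrame f)
    (e : (K ⊗[k] V) ≃ₗ[K] (K ⊗[k] V)) : (F.map e).IsFrame fun x i => e (f x i) := by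
  intro x
  refine ⟨(hf x).1.map' e.toLinearMap e.ker, ?_⟩
  have := congrArg (Submodule.map (e : (K ⊗[k] V) →ₗ[K] (K ⊗[k] V))) (hf x).2
  rw [Submodule.map_span, ← Set.range_comp] at this
  exact this

/-- A one-parameter unipotent family through `F` tends to `F` for the Zariski topology. -/
theorem tendsto_map_transvection (F : FlagVariety k K V g) (φ : Module.Dual K (K ⊗[k] V))
    (e : K ⊗[k] V) (hφ : φ e = 0) :
    Tendsto (fun t : K => F.map (LinearEquiv.transvection (f := φ) (v := t • e) (by simp [hφ])))
      cofinite (𝓝 F) := by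
  rw [TopologicalSpace.tendsto_nhds_generateFrom_iff]
  rintro _ ⟨p, -, rfl⟩ ⟨f, hf, hne⟩
  -- `P(t)` is `p` evaluated at the frame moved by the transvection with parameter `t`. As `P(0) ≠
  -- 0`, only finitely many `t` leave the open set.
  let P : Polynomial K := MvPolynomial.aeval (fun c : PluckerIndex k K V g =>
    (Matrix.of fun a b => Polynomial.C (c.2 a (f c.1 b)) +
      Polynomial.C (φ (f c.1 b) * c.2 a e) * Polynomial.X).det) p
  have hP (t : K) : P.eval t = MvPolynomial.eval (pluckerCoord fun x i =>
      LinearEquiv.transvection (f := φ) (v := t • e) (by simp [hφ]) (f x i)) p := by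
    rw [← Polynomial.coe_evalRingHom, ← MvPolynomial.coe_aeval_eq_eval]
    simp only [P]
    rw [MvPolynomial.aeval_def, MvPolynomial.hom_eval₂, RingHom.coe_coe, MvPolynomial.aeval_def]
    congr 1
    · ext; simp
    · funext c
      simp only [RingHom.map_det, pluckerCoord]
      congr 1
      ext a b
      simp [LinearMap.transvection, LinearEquiv.transvection]
      ring
  have hP0 : P ≠ 0 := by
    intro h0
    have := hP 0
    rw [h0, Polynomial.eval_zero] at this
    refine hne ?_
    rw [this]
    congr 3
    funext x i
    simp [LinearEquiv.transvection, LinearMap.transvection]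
  refine (Polynomial.finite_setOfPred_isRoot hP0).subset fun t ht => ?_
  by_contra hroot
  exact ht ⟨_, hf.map _, fun h0 => hroot ((hP t).trans h0)⟩

end FlagVariety

section LinearAlgebra

variable {K W : Type*} [Field K] [AddCommGroup W] [Module K W] [FiniteDimensional K W]

theorem Submodule.finrank_add_finrank_inf {A B : Submodule K W} (U : Submodule K W) (hBA : B ≤ A) :
    Module.finrank K B + Module.finrank K ↥(A ⊓ U) =
      Module.finrank K ↥(B ⊔ A ⊓ U) + Module.finrank K ↥(B ⊓ U) := by
  rw [← Submodule.finrank_sup_add_finrank_inf_eq, ← inf_assoc, inf_eq_left.2 hBA]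

theorem Submodule.finrank_inf_ker_add_one {A : Submodule K W} {φ : Module.Dual K W} {u : W}
    (hu : u ∈ A) (hφ : φ u ≠ 0) :
    Module.finrank K ↥(A ⊓ LinearMap.ker φ) + 1 = Module.finrank K A := by
  have hne : φ ∘ₗ A.subtype ≠ 0 := fun h0 => hφ (LinearMap.congr_fun h0 ⟨u, hu⟩)
  rw [← Module.Dual.finrank_ker_add_one_of_ne_zero hne, LinearMap.ker_comp,
    ← Submodule.finrank_map_subtype_eq A, Submodule.map_comap_subtype]

end LinearAlgebra

theorem Submodule.finrank_baseChange_eq {k V : Type*} (K : Type*) [Field k] [Field K] [Algebra k K]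
    [AddCommGroup V] [Module k V] (U : Submodule k V) :
    Module.finrank K (U.baseChange K) = Module.finrank k U := by
  rw [Submodule.baseChange, LinearMap.finrank_range_of_inj, Module.finrank_baseChange]
  exact Module.Flat.lTensor_preserves_injective_linearMap _ U.injective_subtype

/-! ### Schubert cells of a fixed subspace -/

namespace FlagVariety

variable {k K V : Type*} [Field k] [Field K] [Algebra k K] [AddCommGroup V] [Module k V]
  {g : ℝ →₀ ℕ}

variable (g) in
/-- The filtrations which induce on `U` a filtration of type `h`. -/
def schubertCell (U : Submodule K (K ⊗[k] V)) (h : ℝ →₀ ℕ) : Set (FlagVariety k K V g) :=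
  {F | ∀ x, Module.finrank K ↥(F.filtration x ⊓ U) = stepDim h x}

variable [FiniteDimensional k V]

theorem mem_subfunctionLocus_iff {F : FlagVariety k K V g} {h : ℝ →₀ ℕ} :
    F ∈ subfunctionLocus k K V g h ↔
      ∃ U : Submodule k V, Module.finrank k U = h.degree ∧ F ∈ schubertCell g (U.baseChange K) h := by
  refine exists_congr fun U => and_congr_right fun _ => ?_
  rw [RFiltration.finrank_gr_eq_iff]
  exact forall_congr' fun x => by rw [RFiltration.finrank_restrict]

theorem exists_mem_notMem_plus {F : FlagVariety k K V g} {U : Submodule K (K ⊗[k] V)}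
    {h : ℝ →₀ ℕ} (hF : F ∈ schubertCell g U h) {a : ℝ} (ha : h a ≠ 0) :
    ∃ u ∈ F.filtration a ⊓ U, u ∉ F.filtration.plus a := by
  by_contra! hcon
  obtain ⟨y, h1, h2⟩ :=
    ((F.filtration.eventually_eq_plus a).and (eventually_stepDim_right h a)).exists
  have h3 : F.filtration a ⊓ U ≤ F.filtration y ⊓ U :=
    le_inf (fun u hu => h1 ▸ hcon u hu) inf_le_right
  have h4 := Submodule.finrank_mono h3
  rw [hF, hF] at h4
  omega

/-- Otherwise `F^b ∩ U` would surject onto `gr^b`, forcing `h b ≥ g b`. -/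
theorem exists_mem_notMem_sup_plus {F : FlagVariety k K V g} {U : Submodule K (K ⊗[k] V)}
    {h : ℝ →₀ ℕ} (hF : F ∈ schubertCell g U h) {b : ℝ} (hb : h b < g b) :
    ∃ e ∈ F.filtration b, e ∉ U ⊔ F.filtration.plus b := by
  by_contra! hcon
  obtain ⟨y, ⟨h1, h2⟩, h3⟩ := (((F.filtration.eventually_eq_plus b).and
    (eventually_stepDim_right h b)).and (eventually_stepDim_right g b)).exists
  have hyb : F.filtration y ≤ F.filtration b := h1 ▸ F.filtration.plus_le b
  have h4 : F.filtration b ≤ F.filtration y ⊔ F.filtration b ⊓ U := by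
    rw [inf_comm, ← sup_inf_assoc_of_le U hyb, le_inf_iff, sup_comm, h1]
    exact ⟨hcon, le_rfl⟩
  have h5 := Submodule.finrank_mono h4
  have h6 := Submodule.finrank_add_finrank_inf U hyb
  rw [hF, hF, finrank_step] at h6
  rw [finrank_step] at h5
  omega

/-- Moving one unit of the type on `U` from `a` down to `b` is a generization. -/
theorem mem_closure_schubertCell_of_move [Infinite K] {F : FlagVariety k K V g}
    {U : Submodule K (K ⊗[k] V)} {c : ℝ →₀ ℕ} {a b : ℝ} (hba : b < a)
    (hF : F ∈ schubertCell g U (c + Finsupp.single a 1))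
    (hb : (c + Finsupp.single a 1 : ℝ →₀ ℕ) b < g b) :
    F ∈ closure (schubertCell g U (c + Finsupp.single b 1)) := by
  obtain ⟨u, ⟨hua, huU⟩, hu⟩ := exists_mem_notMem_plus hF (a := a) (by simp)
  obtain ⟨e, heb, he⟩ := exists_mem_notMem_sup_plus hF hb
  have hle {x : ℝ} (hx : b < x) : F.filtration x ≤ U ⊔ F.filtration.plus b :=
    (F.filtration.le_plus hx).trans le_sup_right
  -- This gives a form `φ` that kills `e` and `F^{a+}` but not `u`. A relation involving `e` would
  -- put `e` in `F^a`, hence in `F^{b+}` because `b < a`.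
  have hue : u ∉ F.filtration.plus a ⊔ Submodule.span K {e} := by
    intro hmem
    obtain ⟨f, hf, _, hs, hfs⟩ := Submodule.mem_sup.1 hmem
    obtain ⟨s, rfl⟩ := Submodule.mem_span_singleton.1 hs
    rcases eq_or_ne s 0 with rfl | hs0
    · rw [zero_smul, add_zero] at hfs
      exact hu (hfs ▸ hf)
    · refine he (hle hba ((Submodule.smul_mem_iff _ hs0).1 ?_))
      rw [← eq_sub_iff_add_eq'] at hfs
      rw [hfs]
      exact Submodule.sub_mem _ hua (F.filtration.plus_le a hf)
  obtain ⟨φ, hφu, hφ⟩ := Submodule.exists_le_ker_of_notMem hue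
  rw [sup_le_iff, Submodule.span_singleton_le_iff_mem, LinearMap.mem_ker] at hφ
  refine mem_closure_of_tendsto (F.tendsto_map_transvection φ e hφ.2) ?_
  filter_upwards [(Set.finite_singleton (0 : K)).compl_mem_cofinite] with t ht x
  have ht : t ≠ 0 := ht
  set T := LinearEquiv.transvection (f := φ) (v := t • e) (by simp [hφ.2]) with hT
  have hTapp (v : K ⊗[k] V) : T v = v + φ v • t • e := rfl
  change Module.finrank K ↥((F.filtration x).map (T : (K ⊗[k] V) →ₗ[K] (K ⊗[k] V)) ⊓ U) = _
  have hFx := hF x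
  rw [stepDim_add, stepDim_single] at hFx
  rw [stepDim_add, stepDim_single]
  rcases le_or_gt x b with hxb | hbx
  · have hmap : (F.filtration x).map (T : (K ⊗[k] V) →ₗ[K] (K ⊗[k] V)) = F.filtration x := by
      refine Submodule.eq_of_le_of_finrank_eq ?_ (LinearEquiv.finrank_map_eq T _)
      rintro _ ⟨v, hv, rfl⟩
      exact Submodule.add_mem _ hv
        (Submodule.smul_mem _ _ (Submodule.smul_mem _ _ (F.filtration.antitone' hxb heb)))
    rw [hmap, hFx, if_pos hxb, if_pos (hxb.trans hba.le)]
  -- If `T v ∈ U` with `φ v ≠ 0`, then `e` is a multiple of `T v - v`, which lies in `U + F^{b+}`: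
  -- excluded. So the intersection is cut by `ker φ`, losing one dimension exactly for `b < x ≤ a`.
  have hmap : (F.filtration x).map (T : (K ⊗[k] V) →ₗ[K] (K ⊗[k] V)) ⊓ U =
      (F.filtration x ⊓ U) ⊓ LinearMap.ker φ := by
    ext w
    constructor
    · rintro ⟨⟨v, hv, rfl⟩, hw⟩
      change T v ∈ U at hw
      change T v ∈ _
      have hv0 : φ v = 0 := by
        by_contra hne
        refine he ?_
        rw [← Submodule.smul_mem_iff _ ht, ← Submodule.smul_mem_iff _ hne,
          ← add_sub_cancel_left v (φ v • t • e), ← hTapp]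
        exact Submodule.sub_mem _ (Submodule.mem_sup_left hw) (hle hbx hv)
      have hTv : T v = v := by rw [hTapp, hv0, zero_smul, add_zero]
      rw [hTv] at hw ⊢
      exact ⟨⟨hv, hw⟩, hv0⟩
    · rintro ⟨⟨hw, hwU⟩, hw0⟩
      refine ⟨⟨w, hw, ?_⟩, hwU⟩
      change T w = w
      rw [hTapp, LinearMap.mem_ker.1 hw0, zero_smul, add_zero]
  rw [hmap, if_neg (not_le.2 hbx)]
  rcases le_or_gt x a with hxa | hax
  · have := Submodule.finrank_inf_ker_add_one (A := F.filtration x ⊓ U)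
      ⟨F.filtration.antitone' hxa hua, huU⟩ hφu
    rw [if_pos hxa] at hFx
    omega
  · rw [inf_eq_left.2 (inf_le_left.trans ((F.filtration.le_plus hax).trans hφ.1)), hFx,
      if_neg (not_le.2 hax)]

/-- Induction on the total excess of `h'` over `h` (truncated subtraction), which each move lowers.
Room in `gr^b` for a move comes from `h' b < h b ≤ g b`. -/
theorem schubertCell_subset_closure [Infinite K] (U : Submodule K (K ⊗[k] V)) {h' h : ℝ →₀ ℕ}
    (hg : h ≤ g) (hdeg : h'.degree = h.degree) (hstep : ∀ x, stepDim h x ≤ stepDim h' x) :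
    schubertCell g U h' ⊆ closure (schubertCell g U h) := by
  induction hn : (h' - h).degree using Nat.strong_induction_on generalizing h' with
  | _ n ih =>
    rcases eq_or_ne h' h with rfl | hne
    · exact subset_closure
    obtain ⟨c, a, b, hba, rfl, hb, hstep', hlt⟩ := exists_move hdeg hstep hne
    have hdeg' : (c + Finsupp.single b 1).degree = h.degree := by
      simpa using hdeg
    intro F hF
    exact closure_minimal (ih _ (hn ▸ hlt) hdeg' hstep' rfl) isClosed_closure
      (mem_closure_schubertCell_of_move hba hF (hb.trans_le (hg b)))

/-- The graded pieces of the induced filtration embed in those of `F`, so its type is bounded by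
`g`; its degree is read off where `F^x` is everything. -/
theorem exists_le_mem_schubertCell (F : FlagVariety k K V g) (U : Submodule K (K ⊗[k] V)) :
    ∃ h ≤ g, h.degree = Module.finrank K U ∧ F ∈ schubertCell g U h := by
  have hle (x : ℝ) : Module.finrank K ((F.filtration.restrict U).Gr x) ≤ g x := by
    obtain ⟨y, ⟨h1, h2⟩, h3⟩ := (((F.filtration.eventually_eq_plus x).and
      ((F.filtration.restrict U).eventually_eq_plus x)).and (eventually_stepDim_right g x)).exists
    have hyx : F.filtration y ≤ F.filtration x := h1 ▸ F.filtration.plus_le x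
    have h4 := (F.filtration.restrict U).finrank_gr_add_finrank_plus x
    have h2' := F.filtration.finrank_restrict U y
    rw [h2] at h2'
    rw [h2', F.filtration.finrank_restrict] at h4
    have h5 := Submodule.finrank_add_finrank_inf U hyx
    have h6 := Submodule.finrank_mono (sup_le hyx (inf_le_left (b := U)))
    rw [finrank_step] at h5 h6
    omega
  let h : ℝ →₀ ℕ := Finsupp.onFinset g.support
    (fun x => Module.finrank K ((F.filtration.restrict U).Gr x)) fun x hx => by
      have := hle x
      rw [Finsupp.mem_support_iff]
      omega
  have hF : F ∈ schubertCell g U h := fun x => by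
    rw [← RFiltration.finrank_restrict]
    exact ((F.filtration.restrict U).finrank_gr_eq_iff h).1 (fun _ => rfl) x
  refine ⟨h, hle, ?_, hF⟩
  obtain ⟨a, ha⟩ := exists_stepDim_eq_degree h
  obtain ⟨a', ha'⟩ := F.filtration.exists_eq_top'
  rw [← ha _ (min_le_left a a'), ← hF, ha' _ (min_le_right a a'), top_inf_eq]

end FlagVariety

/-! ### The closure of `Y(h)` -/

open FlagVariety in
theorem proposition2p3 {k K V : Type*} [Field k] [Finite k] [Field K] [Algebra k K]
    [IsAlgClosed K] [AddCommGroup V] [Module k V] [FiniteDimensional k V]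
    (g : ℝ →₀ ℕ) (hg_dim : g.degree = Module.finrank k V)
    (hg_zero : ∑ x ∈ g.support, x * (g x : ℝ) = 0)
    (h : ℝ →₀ ℕ) (hh : h ∈ NontrivialSubfunction g) :
    closure (subfunctionLocus k K V g h) =
      ⋃ h' ∈ {h' | h' ∈ NontrivialSubfunction g ∧ SubfunctionGE h' h},
        subfunctionLocus k K V g h' := by
  have : Finite V := Module.finite_of_finite k
  obtain ⟨hhg, hh0, hhne⟩ := hh
  apply Set.Subset.antisymm
  · have hclosed : IsClosed (⋃ U : {U : Submodule k V // Module.finrank k U = h.degree},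
        {F : FlagVariety k K V g | ∀ x,
          stepDim h x ≤ Module.finrank K ↥(F.filtration x ⊓ U.1.baseChange K)}) := by
      refine isClosed_iUnion_of_finite fun U => ?_
      rw [Set.ofPred_forall]
      exact isClosed_iInter fun x => isClosed_le_finrank_inf _ x _
    refine (closure_minimal (fun F hF => ?_) hclosed).trans fun F hF => ?_
    · obtain ⟨U, hU, hF⟩ := mem_subfunctionLocus_iff.1 hF
      exact Set.mem_iUnion.2 ⟨⟨U, hU⟩, fun x => (hF x).ge⟩
    · obtain ⟨⟨U, hU⟩, hF⟩ := Set.mem_iUnion.1 hF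
      obtain ⟨h', hle, hdeg, hF'⟩ := F.exists_le_mem_schubertCell (U.baseChange K)
      rw [Submodule.finrank_baseChange_eq, hU] at hdeg
      refine Set.mem_biUnion (x := h') ⟨⟨hle, ?_, ?_⟩, subfunctionGE_iff.2 ⟨hdeg, fun x => ?_⟩⟩
        (mem_subfunctionLocus_iff.2 ⟨U, hU.trans hdeg.symm, hF'⟩)
      · rintro rfl
        rw [map_zero] at hdeg
        exact hh0 ((Finsupp.degree_eq_zero_iff _).1 hdeg.symm)
      · rintro rfl
        exact hhne (Finsupp.eq_of_le_of_degree_eq hhg hdeg.symm)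
      · exact (hF x).trans (hF' x).le
  · refine Set.iUnion₂_subset fun h' ⟨_, hge⟩ F hF => ?_
    obtain ⟨hdeg, hstep⟩ := subfunctionGE_iff.1 hge
    obtain ⟨U, hU, hF⟩ := mem_subfunctionLocus_iff.1 hF
    refine closure_mono (fun F' hF' => ?_) (schubertCell_subset_closure _ hhg hdeg hstep hF)
    exact mem_subfunctionLocus_iff.2 ⟨U, hU.trans hdeg, hF'⟩
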